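/- Let $\mathbb D=\{z\in\mathbb C: |z|<1\}$, let $\mathbb T=\partial\mathbb D$, and let $m$ be the normalized Lebesgue measure on $\mathbb T$. A \emph{symbol} is an analytic map $\phi:\mathbb D\to\mathbb D$ whose boundary values $\phi^*(\xi)=\lim_{r\to1^-}\phi(r\xi)$ satisfy $|\phi^*|<1$ $m$-almost everywhere on $\mathbb T$. Let $m_\phi$ be the pull-back measure on $\mathbb D$, defined by $m_\phi(B)=m(\{\xi\in\mathbb T:\phi^*(\xi)\in B\})$ for every Borel set $B\subseteq\mathbb D$. The Carleson function of $\phi$ is $$\rho_\phi(h)=\sup_{\xi\in\mathbb T} m_\phi\big(W(\xi,h)\big),\qquad W(\xi,h)=\{z\in\mathbb D:\ |z|\ge 1-h,\ |\arg(z\bar\xi)|\le h\},\qquad 0<h<1.$$ For every $\alpha$ with $1<\alpha<2$, there exist two symbols $\phi_1$ and $\phi_2$ with the same modulus on the boundary, that is, $|\phi_1^*|=|\phi_2^*|$ $m$-almost everywhere on $\mathbb T$, such that, as $h\to0^+$, $$\rho_{\phi_1}(h)\approx h\qquad\text{and}\qquad \rho_{\phi_2}(h)\approx h^\alpha.$$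 Here $u(h)\approx v(h)$ means that there are constants $0<c<C<\infty$ such that $c\,u(h)\le v(h)\le C\,u(h)$ for all sufficiently small $h>0$. -/

import Mathlib

open Set Filter Topology MeasureTheory Asymptotics

noncomputable section

instance : MeasurableSpace Circle := borel Circle

instance : BorelSpace Circle := ⟨rfl⟩

/-- The normalized Lebesgue measure `m` on the unit circle: the image of `dt / 2π` on `(-π, π]`
under `t ↦ e^{it}`. -/
def circleMeasure : Measure Circle :=
  ENNReal.ofReal (2 * Real.pi)⁻¹ •
    (volume.restrict (Ioc (-Real.pi) Real.pi)).map (fun t : ℝ => Circle.exp t)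

/-- `φ` has the radial limit `w` at the point `ξ` of the unit circle. -/
def HasRadialLimit (φ : ℂ → ℂ) (ξ : Circle) (w : ℂ) : Prop :=
  Tendsto (fun r : ℝ => φ ((r : ℂ) * (ξ : ℂ))) (𝓝[<] 1) (𝓝 w)

/-- The boundary values function `φ*`, given by radial limits. It has an arbitrary value at the
points where there is no radial limit; these form a null set when `φ` is analytic and bounded on
the unit disc. -/
def boundaryValue (φ : ℂ → ℂ) (ξ : Circle) : ℂ :=
  limUnder (𝓝[<] (1 : ℝ)) (fun r : ℝ => φ ((r : ℂ) * (ξ : ℂ)))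

/-- A symbol: an analytic self-map of the open unit disc whose boundary values satisfy
`|φ*| < 1` almost everywhere on the unit circle. Only the values of `φ` on the disc matter. -/
structure IsSymbol (φ : ℂ → ℂ) : Prop where
  differentiableOn : DifferentiableOn ℂ φ (Metric.ball 0 1)
  mapsTo : MapsTo φ (Metric.ball 0 1) (Metric.ball 0 1)
  ae_boundary : ∀ᵐ ξ ∂circleMeasure, ∃ w : ℂ, ‖w‖ < 1 ∧ HasRadialLimit φ ξ w

/-- The pull-back measure `m_φ` on the open unit disc: `m_φ(B) = m {ξ | φ*(ξ) ∈ B}` for every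
Borel subset `B` of the disc. -/
def pullbackMeasure (φ : ℂ → ℂ) : Measure ℂ :=
  (circleMeasure.map (boundaryValue φ)).restrict (Metric.ball 0 1)

/-- The Carleson window `W(ξ, h)`. -/
def carlesonWindow (ξ : Circle) (h : ℝ) : Set ℂ :=
  {z : ℂ | ‖z‖ < 1 ∧ 1 - h ≤ ‖z‖ ∧ |Complex.arg (z * (starRingEnd ℂ) (ξ : ℂ))| ≤ h}

/-- The Carleson function `ρ_μ(h) = sup_ξ μ(W(ξ, h))` of a finite measure `μ`. -/
def carlesonFunction (μ : Measure ℂ) (h : ℝ) : ℝ :=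
  (⨆ ξ : Circle, μ (carlesonWindow ξ h)).toReal

end

/-! The Cayley transform w = (1+z)/(1-z) carries the disc to the right half-plane and e^{it} to ix,
where x = cot(t/2) is `halfCot t`. For 0 < a, b < 1 the function g(w) = w + w^a + w^{-b} has
positive real part, so φ₁ = (g-1)/(g+1) is a self-map of the disc. It touches the unit circle only
at z = ±1, with limit 1 both times, and 1 - |φ₁|² = 4 Re g / |g+1|².

At z = -1 (x → 0) both |1 - φ₁| and 1 - |φ₁| are of order x^b: the image has a corner, and this end
gives windows mass of order h^{1/b}. At z = 1 (x → ∞) |1 - φ₁| is of order 1/x, hence of order |t|,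
while 1 - |φ₁| is of order x^{a-2}: the contact is tangential, and this end contributes order h.
Since 1/b > 1, the total for φ₁ is of order h.

Put φ₂ = φ₁ e^{-w}. The new factor is unimodular on the circle, so the boundary modulus is
unchanged, and it is close to 1 at the corner, whose contribution persists. At x → ∞ it rotates the
values at unit speed in x. Being within h of the circle forces x ≥ X with X of order h^{-1/(2-a)},
and in each unit interval of x a window captures only a set of length O(h). As dt is of order dx/x²,
this end now contributes O(h/X) = O(h^{1+1/(2-a)}). This is negligible or comparable when 1/b ≤ 1 +
1/(2-a); the choice b = 1/α, a = α - 1 satisfies this.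

The upper bounds are `exists_volume_outerSymbol_le` and `exists_volume_twistedSymbol_le`; the lower
bounds use only the window at 1. -/

noncomputable section

/-! ### Half-plane model and Cayley transform of the target -/

/-- A holomorphic function on the right half-plane, with positive real part, which behaves like `w`
at infinity and like `w ^ (-b)` at the origin. -/
def powerSum (a b : ℝ) (w : ℂ) : ℂ :=
  w + w ^ (a : ℂ) + w ^ ((-b : ℝ) : ℂ)

/-- The self-map of the disc obtained from `powerSum` by Cayley transforms, read in the
half-plane. -/
def halfPlaneSymbol (a b : ℝ) (w : ℂ) : ℂ :=
  (powerSum a b w - 1) / (powerSum a b w + 1)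

lemma re_cpow_pos {w : ℂ} (hw : 0 ≤ w.re) (hw0 : w ≠ 0) {p : ℝ} (hp : |p| < 1) :
    0 < (w ^ (p : ℂ)).re := by
  rw [Complex.cpow_ofReal_re]
  refine mul_pos (Real.rpow_pos_of_pos (norm_pos_iff.2 hw0) _) ?_
  have h1 : |w.arg * p| < Real.pi / 2 := by
    rw [abs_mul]
    have := Complex.abs_arg_le_pi_div_two_iff.2 hw
    have := Real.pi_pos
    nlinarith [abs_nonneg w.arg, abs_nonneg p]
  exact Real.cos_pos_of_mem_Ioo (abs_lt.1 h1)

lemma powerSum_re_pos {a b : ℝ} (ha : |a| < 1) (hb : |b| < 1) {w : ℂ} (hw : 0 ≤ w.re)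
    (hw0 : w ≠ 0) : 0 < (powerSum a b w).re := by
  have h1 := re_cpow_pos hw hw0 ha
  have h2 := re_cpow_pos hw hw0 (p := -b) (by rwa [abs_neg])
  simp only [powerSum, Complex.add_re]
  linarith

lemma add_one_ne_zero_of_re_pos {g : ℂ} (hg : 0 < g.re) : g + 1 ≠ 0 := by
  intro h
  have := congrArg Complex.re h
  simp at this
  linarith

lemma one_sub_normSq_div {g : ℂ} (hg : 0 < g.re) :
    1 - ‖(g - 1) / (g + 1)‖ ^ 2 = 4 * g.re / ‖g + 1‖ ^ 2 := by
  have h : ‖g + 1‖ ^ 2 ≠ 0 := by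
    have := norm_ne_zero_iff.2 (add_one_ne_zero_of_re_pos hg)
    positivity
  rw [norm_div, div_pow, eq_div_iff h, sub_mul, div_mul_cancel₀ _ h, ← Complex.normSq_eq_norm_sq,
    ← Complex.normSq_eq_norm_sq, Complex.normSq_apply, Complex.normSq_apply]
  simp
  ring

lemma norm_div_lt_one {g : ℂ} (hg : 0 < g.re) : ‖(g - 1) / (g + 1)‖ < 1 := by
  have h := one_sub_normSq_div hg
  have h' : 0 < 4 * g.re / ‖g + 1‖ ^ 2 := by
    have := norm_pos_iff.2 (add_one_ne_zero_of_re_pos hg)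
    positivity
  nlinarith [norm_nonneg ((g - 1) / (g + 1))]

lemma div_sub_div_eq {g g' : ℂ} (hg : 0 < g.re) (hg' : 0 < g'.re) :
    (g - 1) / (g + 1) - (g' - 1) / (g' + 1) = 2 * (g - g') / ((g + 1) * (g' + 1)) := by
  have h1 := add_one_ne_zero_of_re_pos hg
  have h2 := add_one_ne_zero_of_re_pos hg'
  field_simp
  ring

/-! ### Boundary estimates on the positive imaginary axis -/

section ImaginaryAxis

variable {a b : ℝ}

lemma norm_ofReal_mul_I {x : ℝ} (hx : 0 < x) : ‖(x : ℂ) * Complex.I‖ = x := by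
  simp [abs_of_pos hx]

lemma arg_ofReal_mul_I {x : ℝ} (hx : 0 < x) : ((x : ℂ) * Complex.I).arg = Real.pi / 2 := by
  rw [Complex.arg_real_mul _ hx, Complex.arg_I]

lemma ofReal_mul_I_cpow {x : ℝ} (hx : 0 < x) (p : ℝ) :
    ((x : ℂ) * Complex.I) ^ (p : ℂ) = ((x ^ p : ℝ) : ℂ) * Complex.I ^ (p : ℂ) := by
  apply Complex.ext
  · rw [Complex.cpow_ofReal_re, Complex.re_ofReal_mul, Complex.cpow_ofReal_re,
      norm_ofReal_mul_I hx, arg_ofReal_mul_I hx, Complex.arg_I]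
    simp
  · rw [Complex.cpow_ofReal_im, Complex.im_ofReal_mul, Complex.cpow_ofReal_im,
      norm_ofReal_mul_I hx, arg_ofReal_mul_I hx, Complex.arg_I]
    simp

lemma norm_I_cpow (p : ℝ) : ‖Complex.I ^ (p : ℂ)‖ = 1 := by
  rw [Complex.norm_cpow_real]; simp

lemma powerSum_ofReal_mul_I {x : ℝ} (hx : 0 < x) :
    powerSum a b (x * Complex.I) = x * Complex.I + ((x ^ a : ℝ) : ℂ) * Complex.I ^ (a : ℂ) +
      ((x ^ (-b) : ℝ) : ℂ) * Complex.I ^ ((-b : ℝ) : ℂ) := by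
  rw [powerSum, ofReal_mul_I_cpow hx, ofReal_mul_I_cpow hx]

lemma powerSum_re {x : ℝ} (hx : 0 < x) :
    (powerSum a b (x * Complex.I)).re =
      x ^ a * Real.cos (Real.pi / 2 * a) + x ^ (-b) * Real.cos (Real.pi / 2 * b) := by
  rw [powerSum_ofReal_mul_I hx]
  simp only [Complex.add_re, Complex.re_ofReal_mul, Complex.I_re, Complex.cpow_ofReal_re,
    Complex.arg_I, Complex.norm_I, Real.one_rpow, mul_neg, Real.cos_neg]
  ring

lemma powerSum_im {x : ℝ} (hx : 0 < x) :
    (powerSum a b (x * Complex.I)).im =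
      x + x ^ a * Real.sin (Real.pi / 2 * a) - x ^ (-b) * Real.sin (Real.pi / 2 * b) := by
  rw [powerSum_ofReal_mul_I hx]
  simp only [Complex.add_im, Complex.im_ofReal_mul, Complex.I_im, Complex.cpow_ofReal_im,
    Complex.arg_I, Complex.norm_I, Real.one_rpow, mul_neg, Real.sin_neg]
  ring

lemma powerSum_re_pos_axis (ha : a ∈ Ioo (0 : ℝ) 1) (hb : b ∈ Ioo (0 : ℝ) 1) {x : ℝ}
    (hx : 0 < x) : 0 < (powerSum a b (x * Complex.I)).re :=
  powerSum_re_pos (by rw [abs_of_pos ha.1]; exact ha.2) (by rw [abs_of_pos hb.1]; exact hb.2)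
    (by simp) (by simp [hx.ne'])

lemma cos_half_pi_mul_pos (ha : a ∈ Ioo (0 : ℝ) 1) : 0 < Real.cos (Real.pi / 2 * a) :=
  Real.cos_pos_of_mem_Ioo ⟨by nlinarith [Real.pi_pos, ha.1], by nlinarith [Real.pi_pos, ha.2]⟩

lemma sin_half_pi_mul_pos (ha : a ∈ Ioo (0 : ℝ) 1) : 0 < Real.sin (Real.pi / 2 * a) :=
  Real.sin_pos_of_pos_of_lt_pi (mul_pos (by positivity) ha.1)
    (by nlinarith [Real.pi_pos, ha.2])

lemma norm_powerSum_add_one_le {x : ℝ} (hx : 0 < x) :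
    ‖powerSum a b (x * Complex.I) + 1‖ ≤ x + x ^ a + x ^ (-b) + 1 := by
  rw [powerSum_ofReal_mul_I hx]
  refine (norm_add_le _ _).trans (add_le_add ((norm_add_le _ _).trans
    (add_le_add ((norm_add_le _ _).trans (add_le_add ?_ ?_)) ?_)) ?_)
  · rw [norm_ofReal_mul_I hx]
  · rw [norm_mul, norm_I_cpow, mul_one, Complex.norm_real, Real.norm_of_nonneg (by positivity)]
  · rw [norm_mul, norm_I_cpow, mul_one, Complex.norm_real, Real.norm_of_nonneg (by positivity)]
  · simp

lemma norm_powerSum_add_one_le_of_one_le (ha : a ∈ Ioo (0 : ℝ) 1) (hb : b ∈ Ioo (0 : ℝ) 1)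
    {x : ℝ} (hx : 1 ≤ x) : ‖powerSum a b (x * Complex.I) + 1‖ ≤ 4 * x := by
  have h1 := norm_powerSum_add_one_le (a := a) (b := b) (x := x) (by linarith)
  have h2 : x ^ a ≤ x := Real.rpow_le_self_of_one_le hx ha.2.le
  have h3 : x ^ (-b) ≤ 1 := Real.rpow_le_one_of_one_le_of_nonpos hx (by linarith [hb.1])
  linarith

lemma norm_powerSum_add_one_le_of_le_one (ha : a ∈ Ioo (0 : ℝ) 1) (hb : b ∈ Ioo (0 : ℝ) 1)
    {x : ℝ} (hx0 : 0 < x) (hx : x ≤ 1) :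
    ‖powerSum a b (x * Complex.I) + 1‖ ≤ 4 * x ^ (-b) := by
  have h1 := norm_powerSum_add_one_le (a := a) (b := b) hx0
  have h2 : x ^ a ≤ 1 := Real.rpow_le_one hx0.le hx ha.1.le
  have h3 : 1 ≤ x ^ (-b) := Real.one_le_rpow_of_pos_of_le_one_of_nonpos hx0 hx (by linarith [hb.1])
  linarith

lemma half_le_norm_powerSum_add_one (ha : a ∈ Ioo (0 : ℝ) 1) (hb : b ∈ Ioo (0 : ℝ) 1)
    {x : ℝ} (hx : 2 ≤ x) : x / 2 ≤ ‖powerSum a b (x * Complex.I) + 1‖ := by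
  refine le_trans ?_ (Complex.abs_im_le_norm _)
  rw [Complex.add_im, Complex.one_im, powerSum_im (by linarith)]
  refine le_trans ?_ (le_abs_self _)
  have h3 : x ^ (-b) ≤ 1 :=
    Real.rpow_le_one_of_one_le_of_nonpos (by linarith) (by linarith [hb.1])
  have h4 : 0 < x ^ a := Real.rpow_pos_of_pos (by linarith) _
  have h5 : 0 < x ^ (-b) := Real.rpow_pos_of_pos (by linarith) _
  have h6 := sin_half_pi_mul_pos ha
  have h7 := sin_half_pi_mul_pos hb
  have h8 := Real.sin_le_one (Real.pi / 2 * b)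
  nlinarith [mul_pos h4 h6]

lemma rpow_mul_cos_le_norm_powerSum_add_one (ha : a ∈ Ioo (0 : ℝ) 1) {x : ℝ} (hx : 0 < x) :
    x ^ (-b) * Real.cos (Real.pi / 2 * b) ≤ ‖powerSum a b (x * Complex.I) + 1‖ := by
  refine le_trans ?_ (Complex.re_le_norm _)
  rw [Complex.add_re, Complex.one_re, powerSum_re hx]
  have := mul_pos (Real.rpow_pos_of_pos hx a) (cos_half_pi_mul_pos ha)
  linarith

/-- The imaginary part is x plus the two increasing functions x^a sin(πa/2) and -x^{-b} sin(πb/2),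
so its increments are at least those of x. -/
lemma abs_sub_le_norm_powerSum_sub (ha : a ∈ Ioo (0 : ℝ) 1) (hb : b ∈ Ioo (0 : ℝ) 1)
    {x y : ℝ} (hx : 0 < x) (hy : 0 < y) :
    |x - y| ≤ ‖powerSum a b (x * Complex.I) - powerSum a b (y * Complex.I)‖ := by
  wlog hxy : y ≤ x generalizing x y
  · rw [abs_sub_comm, norm_sub_rev]
    exact this hy hx (le_of_not_ge hxy)
  refine le_trans ?_ (Complex.abs_im_le_norm _)
  rw [Complex.sub_im, powerSum_im hx, powerSum_im hy, abs_of_nonneg (by linarith)]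
  refine le_trans ?_ (le_abs_self _)
  have h1 : y ^ a ≤ x ^ a := Real.rpow_le_rpow hy.le hxy ha.1.le
  have h2 : x ^ (-b) ≤ y ^ (-b) := Real.rpow_le_rpow_of_nonpos hy hxy (by linarith [hb.1])
  nlinarith [sin_half_pi_mul_pos ha, sin_half_pi_mul_pos hb]

lemma rpow_sub_rpow_le_sub {x y p : ℝ} (hy : 1 ≤ y) (hxy : y ≤ x) (hp : p ≤ 1) :
    x ^ p - y ^ p ≤ x - y := by
  have hy0 : 0 < y := by linarith
  have h1 : x ^ p = y ^ p * (x / y) ^ p := by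
    rw [← Real.mul_rpow hy0.le (div_nonneg (hy0.le.trans hxy) hy0.le), mul_div_cancel₀ _ hy0.ne']
  have h2 : (x / y) ^ p ≤ x / y := Real.rpow_le_self_of_one_le ((one_le_div hy0).2 hxy) hp
  have h3 : y ^ p ≤ y := Real.rpow_le_self_of_one_le hy hp
  have h4 : 0 < y ^ p := by positivity
  have h5 : x / y - 1 = (x - y) / y := by field_simp
  have h6 : 0 ≤ (x - y) / y := div_nonneg (by linarith) hy0.le
  calc x ^ p - y ^ p = y ^ p * ((x / y) ^ p - 1) := by rw [h1]; ring
    _ ≤ y ^ p * ((x - y) / y) := by rw [← h5]; gcongr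
    _ ≤ y * ((x - y) / y) := by gcongr
    _ = x - y := by field_simp

/-- Negative exponents reduce to positive ones because inversion does not increase distances on [1,
∞). -/
lemma abs_rpow_sub_rpow_le {x y p : ℝ} (hx : 1 ≤ x) (hy : 1 ≤ y) (hp : |p| ≤ 1) :
    |x ^ p - y ^ p| ≤ |x - y| := by
  wlog hxy : y ≤ x generalizing x y
  · rw [abs_sub_comm, abs_sub_comm x]
    exact this hy hx (le_of_not_ge hxy)
  have hx0 : 0 < x := by linarith
  have hy0 : 0 < y := by linarith
  rw [abs_of_nonneg (sub_nonneg.2 hxy)]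
  rcases le_total 0 p with h0 | h0
  · rw [abs_of_nonneg h0] at hp
    rw [abs_of_nonneg (sub_nonneg.2 (Real.rpow_le_rpow hy0.le hxy h0))]
    exact rpow_sub_rpow_le_sub hy hxy hp
  · rw [abs_of_nonpos h0] at hp
    rw [abs_of_nonpos (sub_nonpos.2 (Real.rpow_le_rpow_of_nonpos hy0 hxy h0))]
    have h1 := rpow_sub_rpow_le_sub hy hxy hp
    have h2 : 1 ≤ x ^ (-p) := Real.one_le_rpow hx (by linarith)
    have h3 : 1 ≤ y ^ (-p) := Real.one_le_rpow hy (by linarith)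
    have h4 : y ^ (-p) ≤ x ^ (-p) := Real.rpow_le_rpow hy0.le hxy (by linarith)
    have h5 : x ^ p = (x ^ (-p))⁻¹ := by rw [Real.rpow_neg hx0.le, inv_inv]
    have h6 : y ^ p = (y ^ (-p))⁻¹ := by rw [Real.rpow_neg hy0.le, inv_inv]
    rw [h5, h6, neg_sub, inv_sub_inv (by positivity) (by positivity)]
    refine (div_le_self (by linarith) ?_).trans h1
    nlinarith

lemma norm_powerSum_sub_le (ha : a ∈ Ioo (0 : ℝ) 1) (hb : b ∈ Ioo (0 : ℝ) 1)
    {x y : ℝ} (hx : 1 ≤ x) (hy : 1 ≤ y) :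
    ‖powerSum a b (x * Complex.I) - powerSum a b (y * Complex.I)‖ ≤ 3 * |x - y| := by
  rw [powerSum_ofReal_mul_I (by linarith), powerSum_ofReal_mul_I (by linarith)]
  have h1 := abs_rpow_sub_rpow_le hx hy (p := a) (by rw [abs_of_pos ha.1]; exact ha.2.le)
  have h2 := abs_rpow_sub_rpow_le hx hy (p := -b)
    (by rw [abs_neg, abs_of_pos hb.1]; exact hb.2.le)
  have key : ∀ (u v u' v' u'' v'' : ℝ) (A B C : ℂ), ‖A‖ = 1 → ‖B‖ = 1 → ‖C‖ = 1 →
      ‖((u : ℂ) * A + u' * B + u'' * C) - ((v : ℂ) * A + v' * B + v'' * C)‖ ≤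
        |u - v| + |u' - v'| + |u'' - v''| := by
    intro u v u' v' u'' v'' A B C hA hB hC
    have : ((u : ℂ) * A + u' * B + u'' * C) - ((v : ℂ) * A + v' * B + v'' * C) =
        ((u - v : ℝ) : ℂ) * A + ((u' - v' : ℝ) : ℂ) * B + ((u'' - v'' : ℝ) : ℂ) * C := by
      push_cast; ring
    rw [this]
    refine (norm_add₃_le).trans (le_of_eq ?_)
    simp only [norm_mul, hA, hB, hC, mul_one, Complex.norm_real, Real.norm_eq_abs]
  have := key x y (x ^ a) (y ^ a) (x ^ (-b)) (y ^ (-b)) _ _ _ Complex.norm_I (norm_I_cpow a)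
    (norm_I_cpow (-b))
  linarith

/-- Combines `one_sub_normSq_div` with 1 - (1-h)² ≤ 2h. It turns closeness to the circle into a
growth inequality for g, from which both localizations of x below are read off. -/
lemma one_sub_norm_halfPlaneSymbol (ha : a ∈ Ioo (0 : ℝ) 1) (hb : b ∈ Ioo (0 : ℝ) 1) {x h : ℝ}
    (hx : 0 < x) (hle : 1 - h ≤ ‖halfPlaneSymbol a b (x * Complex.I)‖) (h1 : h < 1) :
    2 * (powerSum a b (x * Complex.I)).re ≤ h * ‖powerSum a b (x * Complex.I) + 1‖ ^ 2 := by
  have hg := powerSum_re_pos_axis ha hb hx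
  have e := one_sub_normSq_div hg
  have hpos := norm_pos_iff.2 (add_one_ne_zero_of_re_pos hg)
  rw [← halfPlaneSymbol] at e
  have : 4 * (powerSum a b (x * Complex.I)).re / ‖powerSum a b (x * Complex.I) + 1‖ ^ 2 ≤ 2 * h := by
    rw [← e]
    have := pow_le_pow_left₀ (by linarith) hle 2
    nlinarith [sq_nonneg h]
  rw [div_le_iff₀ (by positivity)] at this
  linarith

/-- Near the origin, a point where the symbol is within `h` of the unit circle has height
`O(h ^ (1 / b))`. -/
lemma rpow_le_of_one_sub_le (ha : a ∈ Ioo (0 : ℝ) 1) (hb : b ∈ Ioo (0 : ℝ) 1) {x h : ℝ}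
    (hx : 0 < x) (hx1 : x ≤ 1) (hh : 0 < h) (h1 : h < 1)
    (hle : 1 - h ≤ ‖halfPlaneSymbol a b (x * Complex.I)‖) :
    x ≤ (8 / Real.cos (Real.pi / 2 * b)) ^ b⁻¹ * h ^ b⁻¹ := by
  have e := one_sub_norm_halfPlaneSymbol ha hb hx hle h1
  have n := norm_powerSum_add_one_le_of_le_one ha hb hx hx1
  have hc := cos_half_pi_mul_pos hb
  have hca := mul_pos (Real.rpow_pos_of_pos hx a) (cos_half_pi_mul_pos ha)
  rw [powerSum_re hx] at e
  have hxb : 0 < x ^ (-b) := Real.rpow_pos_of_pos hx _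
  have e2 : h * ‖powerSum a b (x * Complex.I) + 1‖ ^ 2 ≤ h * (4 * x ^ (-b)) ^ 2 := by gcongr
  have e3 : x ^ (-b) * Real.cos (Real.pi / 2 * b) ≤ x ^ (-b) * (8 * h * x ^ (-b)) := by
    nlinarith
  have e4 := le_of_mul_le_mul_left e3 hxb
  have e5 : x ^ b ≤ 8 / Real.cos (Real.pi / 2 * b) * h := by
    rw [Real.rpow_neg hx.le, ← div_eq_mul_inv, le_div_iff₀ (by positivity)] at e4
    rw [div_mul_eq_mul_div, le_div_iff₀ hc]
    linarith
  rw [← Real.mul_rpow (by positivity) hh.le]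
  calc x = (x ^ b) ^ b⁻¹ := (Real.rpow_rpow_inv hx.le hb.1.ne').symm
    _ ≤ _ := Real.rpow_le_rpow (by positivity) e5 (inv_nonneg.2 hb.1.le)

/-- Far from the origin, a point where the symbol is within `h` of the unit circle has height at
least of order `h ^ (-1 / (2 - a))`. -/
lemma le_of_one_sub_le (ha : a ∈ Ioo (0 : ℝ) 1) (hb : b ∈ Ioo (0 : ℝ) 1) {x h : ℝ}
    (hx1 : 1 ≤ x) (hh : 0 < h) (h1 : h < 1)
    (hle : 1 - h ≤ ‖halfPlaneSymbol a b (x * Complex.I)‖) :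
    (Real.cos (Real.pi / 2 * a) / 8) ^ (2 - a)⁻¹ * h ^ (-(2 - a)⁻¹) ≤ x := by
  have hx : 0 < x := by linarith
  have e := one_sub_norm_halfPlaneSymbol ha hb hx hle h1
  have n := norm_powerSum_add_one_le_of_one_le ha hb hx1
  have hc := cos_half_pi_mul_pos ha
  have hcb := mul_pos (Real.rpow_pos_of_pos hx (-b)) (cos_half_pi_mul_pos hb)
  rw [powerSum_re hx] at e
  have hxa : 0 < x ^ a := Real.rpow_pos_of_pos hx _
  have e2 : h * ‖powerSum a b (x * Complex.I) + 1‖ ^ 2 ≤ h * (4 * x) ^ 2 := by gcongr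
  have e0 : x ^ 2 = x ^ a * x ^ (2 - a) := by
    rw [← Real.rpow_add hx, add_sub_cancel, Real.rpow_two]
  have e3 : x ^ a * Real.cos (Real.pi / 2 * a) ≤ x ^ a * (8 * h * x ^ (2 - a)) := by
    nlinarith
  have e4 := le_of_mul_le_mul_left e3 hxa
  have e5 : Real.cos (Real.pi / 2 * a) / 8 * h⁻¹ ≤ x ^ (2 - a) := by
    rw [← div_eq_mul_inv, div_le_iff₀ hh]
    linarith
  have h2a : 0 < 2 - a := by linarith [ha.2]
  rw [Real.rpow_neg hh.le, ← Real.inv_rpow hh.le, ← Real.mul_rpow (by positivity) (by positivity)]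
  calc _ ≤ (x ^ (2 - a)) ^ (2 - a)⁻¹ :=
        Real.rpow_le_rpow (by positivity) e5 (inv_nonneg.2 h2a.le)
    _ = x := Real.rpow_rpow_inv hx.le h2a.ne'

lemma norm_halfPlaneSymbol_sub (ha : a ∈ Ioo (0 : ℝ) 1) (hb : b ∈ Ioo (0 : ℝ) 1)
    {x y : ℝ} (hx : 0 < x) (hy : 0 < y) :
    ‖halfPlaneSymbol a b (x * Complex.I) - halfPlaneSymbol a b (y * Complex.I)‖ =
      2 * ‖powerSum a b (x * Complex.I) - powerSum a b (y * Complex.I)‖ /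
        (‖powerSum a b (x * Complex.I) + 1‖ * ‖powerSum a b (y * Complex.I) + 1‖) := by
  rw [halfPlaneSymbol, halfPlaneSymbol,
    div_sub_div_eq (powerSum_re_pos_axis ha hb hx) (powerSum_re_pos_axis ha hb hy)]
  simp

/-- Expansion of the symbol near infinity, in terms of the coordinate `1 / x`. -/
lemma abs_sub_div_le_norm_halfPlaneSymbol_sub (ha : a ∈ Ioo (0 : ℝ) 1) (hb : b ∈ Ioo (0 : ℝ) 1)
    {x y : ℝ} (hx : 1 ≤ x) (hy : 1 ≤ y) :
    |x - y| / (x * y) ≤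
      8 * ‖halfPlaneSymbol a b (x * Complex.I) - halfPlaneSymbol a b (y * Complex.I)‖ := by
  have hx0 : 0 < x := by linarith
  have hy0 : 0 < y := by linarith
  have px := norm_pos_iff.2 (add_one_ne_zero_of_re_pos (powerSum_re_pos_axis ha hb hx0))
  have py := norm_pos_iff.2 (add_one_ne_zero_of_re_pos (powerSum_re_pos_axis ha hb hy0))
  rw [norm_halfPlaneSymbol_sub ha hb hx0 hy0]
  calc |x - y| / (x * y) = 8 * (2 * |x - y| / ((4 * x) * (4 * y))) := by field_simp; ring
    _ ≤ _ := by
      gcongr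
      · exact abs_sub_le_norm_powerSum_sub ha hb hx0 hy0
      · exact norm_powerSum_add_one_le_of_one_le ha hb hx
      · exact norm_powerSum_add_one_le_of_one_le ha hb hy

lemma norm_halfPlaneSymbol_sub_le (ha : a ∈ Ioo (0 : ℝ) 1) (hb : b ∈ Ioo (0 : ℝ) 1)
    {x y : ℝ} (hx : 2 ≤ x) (hy : 2 ≤ y) :
    ‖halfPlaneSymbol a b (x * Complex.I) - halfPlaneSymbol a b (y * Complex.I)‖ ≤
      24 * |x - y| / (x * y) := by
  rw [norm_halfPlaneSymbol_sub ha hb (by linarith) (by linarith)]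
  calc _ ≤ 2 * (3 * |x - y|) / ((x / 2) * (y / 2)) := by
        gcongr
        · exact norm_powerSum_sub_le ha hb (by linarith) (by linarith)
        · exact half_le_norm_powerSum_add_one ha hb hx
        · exact half_le_norm_powerSum_add_one ha hb hy
    _ = _ := by field_simp; ring

lemma norm_exp_mul_I_sub_exp_mul_I {x y : ℝ} (hxy : |x - y| ≤ 1) :
    |x - y| * (3 / 5) ≤
      ‖Complex.exp (-(x * Complex.I)) - Complex.exp (-(y * Complex.I))‖ := by
  have e : Complex.exp (-(x * Complex.I)) - Complex.exp (-(y * Complex.I)) =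
      Complex.exp ((-y : ℝ) * Complex.I) * (Complex.exp (Complex.I * ((y - x : ℝ) : ℂ)) - 1) := by
    rw [mul_sub, ← Complex.exp_add]
    push_cast
    ring_nf
  rw [e, norm_mul, Complex.norm_exp_ofReal_mul_I, one_mul, Complex.norm_exp_I_mul_ofReal_sub_one,
    norm_mul, Real.norm_eq_abs, Real.norm_eq_abs, abs_two]
  have h0 : |Real.sin ((y - x) / 2)| = Real.sin (|x - y| / 2) := by
    rcases le_total x y with h | h
    · rw [abs_of_nonpos (by linarith : x - y ≤ 0), abs_of_nonneg, neg_sub]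
      apply Real.sin_nonneg_of_nonneg_of_le_pi (by linarith)
      rw [abs_of_nonpos (by linarith : x - y ≤ 0)] at hxy
      linarith [Real.pi_gt_three]
    · have : (y - x) / 2 = -((x - y) / 2) := by ring
      rw [this, Real.sin_neg, abs_neg]
      rw [abs_of_nonneg (by linarith : 0 ≤ x - y)] at hxy ⊢
      rw [abs_of_nonneg]
      apply Real.sin_nonneg_of_nonneg_of_le_pi (by linarith)
      linarith [Real.pi_gt_three]
  rw [h0]
  have h1 := Real.mul_le_sin (x := |x - y| / 2) (by positivity) (by linarith [Real.pi_gt_three])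
  have h2 : (3 : ℝ) / 5 ≤ 2 / Real.pi := by
    rw [div_le_div_iff₀ (by norm_num) Real.pi_pos]
    linarith [Real.pi_lt_d2]
  nlinarith [abs_nonneg (x - y)]

/-- The inner factor separates points at bounded distance, up to a constant. -/
lemma abs_sub_le_norm_mul_exp_sub (ha : a ∈ Ioo (0 : ℝ) 1) (hb : b ∈ Ioo (0 : ℝ) 1)
    {x y : ℝ} (hx : 20 ≤ x) (hy : 20 ≤ y) (hxy : |x - y| ≤ 1)
    (hle : 1 / 2 ≤ ‖halfPlaneSymbol a b (x * Complex.I)‖) :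
    |x - y| ≤ 5 * ‖halfPlaneSymbol a b (x * Complex.I) * Complex.exp (-(x * Complex.I)) -
      halfPlaneSymbol a b (y * Complex.I) * Complex.exp (-(y * Complex.I))‖ := by
  set u := halfPlaneSymbol a b (x * Complex.I)
  set v := halfPlaneSymbol a b (y * Complex.I)
  set p := Complex.exp (-(x * Complex.I))
  set q := Complex.exp (-(y * Complex.I)) with hq
  have hq1 : ‖q‖ = 1 := by
    have : q = Complex.exp ((-y : ℝ) * Complex.I) := by rw [hq]; push_cast; ring_nf
    rw [this, Complex.norm_exp_ofReal_mul_I]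
  have e : u * (p - q) = (u * p - v * q) - (u - v) * q := by ring
  have h1 : ‖u‖ * ‖p - q‖ ≤ ‖u * p - v * q‖ + ‖u - v‖ := by
    rw [← norm_mul, e]
    refine (norm_sub_le _ _).trans ?_
    rw [norm_mul, hq1, mul_one]
  have h2 : ‖u - v‖ ≤ 24 * |x - y| / (x * y) :=
    norm_halfPlaneSymbol_sub_le ha hb (by linarith) (by linarith)
  have h3 : 24 * |x - y| / (x * y) ≤ 24 * |x - y| / (20 * 20) := by gcongr
  have h4 : |x - y| * (3 / 5) ≤ ‖p - q‖ := norm_exp_mul_I_sub_exp_mul_I hxy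
  -- Since ‖u‖ ≥ 1/2, the rotation contributes at least (3/10)|x - y|, and the variation of u costs
  -- at most (24/400)|x - y|. The difference is (6/25)|x - y|, which exceeds |x - y|/5.
  nlinarith [norm_nonneg (p - q), abs_nonneg (x - y)]

lemma norm_halfPlaneSymbol_sub_one (ha : a ∈ Ioo (0 : ℝ) 1) (hb : b ∈ Ioo (0 : ℝ) 1) {x : ℝ}
    (hx : 0 < x) :
    ‖halfPlaneSymbol a b (x * Complex.I) - 1‖ = 2 / ‖powerSum a b (x * Complex.I) + 1‖ := by
  have h := add_one_ne_zero_of_re_pos (powerSum_re_pos_axis ha hb hx)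
  have : halfPlaneSymbol a b (x * Complex.I) - 1 = -2 / (powerSum a b (x * Complex.I) + 1) := by
    rw [halfPlaneSymbol]; field_simp; ring
  rw [this, norm_div]; simp

lemma norm_halfPlaneSymbol_sub_one_le (ha : a ∈ Ioo (0 : ℝ) 1) (hb : b ∈ Ioo (0 : ℝ) 1) {x : ℝ}
    (hx : 2 ≤ x) : ‖halfPlaneSymbol a b (x * Complex.I) - 1‖ ≤ 4 / x := by
  rw [norm_halfPlaneSymbol_sub_one ha hb (by linarith)]
  calc _ ≤ 2 / (x / 2) := by
        gcongr
        exact half_le_norm_powerSum_add_one ha hb hx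
    _ = 4 / x := by field_simp; norm_num

/-- At the corner the inner factor is harmless: it differs from 1 by at most x ≤ x^b, which is the
order of the bound for 1 - φ₁. -/
lemma norm_halfPlaneSymbol_mul_exp_sub_one_le (ha : a ∈ Ioo (0 : ℝ) 1) (hb : b ∈ Ioo (0 : ℝ) 1)
    {x : ℝ} (hx : 0 < x) (hx1 : x ≤ 1) :
    ‖halfPlaneSymbol a b (x * Complex.I) * Complex.exp (-(x * Complex.I)) - 1‖ ≤
      (2 / Real.cos (Real.pi / 2 * b) + 1) * x ^ b := by
  set u := halfPlaneSymbol a b (x * Complex.I) with hu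
  set p := Complex.exp (-(x * Complex.I)) with hp
  have hp1 : p = Complex.exp (Complex.I * ((-x : ℝ) : ℂ)) := by rw [hp]; push_cast; ring_nf
  have h1 : ‖p‖ = 1 := by rw [hp1, Complex.norm_exp_I_mul_ofReal]
  have h2 : ‖p - 1‖ ≤ x := by
    rw [hp1]
    refine Real.norm_exp_I_mul_ofReal_sub_one_le.trans ?_
    simp [abs_of_pos hx]
  have h3 : x ≤ x ^ b := Real.self_le_rpow_of_le_one hx.le hx1 hb.2.le
  have hc := cos_half_pi_mul_pos hb
  have h4 : ‖u - 1‖ ≤ 2 / Real.cos (Real.pi / 2 * b) * x ^ b := by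
    rw [hu, norm_halfPlaneSymbol_sub_one ha hb hx]
    have hxb : 0 < x ^ (-b) := by positivity
    calc _ ≤ 2 / (x ^ (-b) * Real.cos (Real.pi / 2 * b)) := by
          gcongr
          exact rpow_mul_cos_le_norm_powerSum_add_one ha hx
      _ = _ := by rw [Real.rpow_neg hx.le]; field_simp
  have e : u * p - 1 = (u - 1) * p + (p - 1) := by ring
  rw [e]
  refine (norm_add_le _ _).trans ?_
  rw [norm_mul, h1]
  linarith

end ImaginaryAxis

/-! ### Boundary values, pull-back measure and Carleson windows -/

lemma measurable_circle_coe : Measurable (fun ξ : Circle => (ξ : ℂ)) :=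
  (by fun_prop : Continuous (fun ξ : Circle => (ξ : ℂ))).measurable

/-- Discards the points ±1, the only boundary points where the symbols are singular. -/
lemma ae_circleMeasure_im_ne_zero : ∀ᵐ ξ : Circle ∂circleMeasure, (ξ : ℂ).im ≠ 0 := by
  refine Measure.ae_smul_measure ?_ _
  have hm : MeasurableSet {ξ : Circle | (ξ : ℂ).im ≠ 0} :=
    ((Complex.measurable_im.comp measurable_circle_coe)
      (measurableSet_singleton 0)).compl
  rw [ae_map_iff Circle.exp.continuous.measurable.aemeasurable hm,
    ae_restrict_iff' measurableSet_Ioc]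
  filter_upwards [compl_mem_ae_iff.2 (measure_singleton (0 : ℝ)),
    compl_mem_ae_iff.2 (measure_singleton Real.pi)] with t h0 hpi ht
  simp only [Set.mem_compl_iff, Set.mem_singleton_iff] at h0 hpi
  rw [Circle.coe_exp, Complex.exp_ofReal_mul_I_im]
  rcases lt_or_gt_of_ne h0 with h | h
  · exact (Real.sin_neg_of_neg_of_neg_pi_lt h ht.1).ne
  · exact (Real.sin_pos_of_pos_of_lt_pi h (lt_of_le_of_ne ht.2 hpi)).ne'

lemma hasRadialLimit_of_continuousAt {φ : ℂ → ℂ} {ξ : Circle} (h : ContinuousAt φ ξ) :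
    HasRadialLimit φ ξ (φ ξ) := by
  have h1 : Tendsto (fun r : ℝ => (r : ℂ) * (ξ : ℂ)) (𝓝[<] 1) (𝓝 (ξ : ℂ)) := by
    have : Continuous (fun r : ℝ => (r : ℂ) * (ξ : ℂ)) := by fun_prop
    simpa using (this.tendsto 1).mono_left nhdsWithin_le_nhds
  exact h.tendsto.comp h1

lemma boundaryValue_eq_of_continuousAt {φ : ℂ → ℂ} {ξ : Circle} (h : ContinuousAt φ ξ) :
    boundaryValue φ ξ = φ ξ :=
  (hasRadialLimit_of_continuousAt h).limUnder_eq

/-- The arc parameters mapped into `B` by `φ`. -/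
def arcPreimage (φ : ℂ → ℂ) (B : Set ℂ) : Set ℝ :=
  {t | t ∈ Ioc (-Real.pi) Real.pi ∧ φ (Circle.exp t) ∈ B}

lemma pullbackMeasure_apply {φ : ℂ → ℂ} (hm : Measurable φ)
    (hφ : ∀ ξ : Circle, (ξ : ℂ).im ≠ 0 → ContinuousAt φ ξ) {B : Set ℂ} (hB : MeasurableSet B)
    (hB1 : B ⊆ Metric.ball 0 1) :
    pullbackMeasure φ B = ENNReal.ofReal (2 * Real.pi)⁻¹ * volume (arcPreimage φ B) := by
  have hcoe : Measurable (fun ξ : Circle => φ ξ) := hm.comp measurable_circle_coe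
  have hexp : Measurable (fun t : ℝ => Circle.exp t) := Circle.exp.continuous.measurable
  have hae : boundaryValue φ =ᵐ[circleMeasure] fun ξ : Circle => φ ξ := by
    filter_upwards [ae_circleMeasure_im_ne_zero] with ξ hξ
    exact boundaryValue_eq_of_continuousAt (hφ ξ hξ)
  rw [pullbackMeasure, Measure.restrict_apply hB, inter_eq_left.2 hB1, Measure.map_congr hae,
    Measure.map_apply hcoe hB, circleMeasure, Measure.smul_apply, smul_eq_mul,
    Measure.map_apply hexp (hcoe hB), Measure.restrict_apply (hexp (hcoe hB)), inter_comm]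
  rfl

lemma measurableSet_carlesonWindow (ξ : Circle) (h : ℝ) : MeasurableSet (carlesonWindow ξ h) := by
  have h1 : Measurable fun z : ℂ => |Complex.arg (z * (starRingEnd ℂ) (ξ : ℂ))| := by
    have : Measurable fun z : ℂ => Complex.arg (z * (starRingEnd ℂ) (ξ : ℂ)) :=
      Complex.measurable_arg.comp (measurable_id.mul_const _)
    exact continuous_abs.measurable.comp this
  exact (measurableSet_lt measurable_norm measurable_const).inter
    ((measurableSet_le measurable_const measurable_norm).inter
      (measurableSet_le h1 measurable_const))

lemma carlesonWindow_subset_ball (ξ : Circle) (h : ℝ) : carlesonWindow ξ h ⊆ Metric.ball 0 1 :=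
  fun z hz => by simpa using hz.1

/-- Moving radially to the circle and then along the arc to ξ costs at most h each. -/
lemma norm_sub_le_of_mem_carlesonWindow {ξ : Circle} {h : ℝ} {z : ℂ}
    (hz : z ∈ carlesonWindow ξ h) : ‖z - ξ‖ ≤ 2 * h := by
  obtain ⟨h1, h2, h3⟩ := hz
  set y := z * (starRingEnd ℂ) (ξ : ℂ) with hy
  have hξ : (starRingEnd ℂ) (ξ : ℂ) * ξ = 1 := by
    rw [mul_comm, Complex.mul_conj]; simp
  have hyn : ‖y‖ = ‖z‖ := by rw [hy, norm_mul, Complex.norm_conj, Circle.norm_coe, mul_one]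
  have e1 : z - ξ = (y - 1) * ξ := by rw [hy, sub_mul, mul_assoc, hξ]; ring
  have e2 : y - 1 = ((‖y‖ - 1 : ℝ) : ℂ) * Complex.exp (Complex.I * (y.arg : ℝ)) +
      (Complex.exp (Complex.I * (y.arg : ℝ)) - 1) := by
    conv_lhs => rw [← Complex.norm_mul_exp_arg_mul_I y]
    push_cast
    ring_nf
  rw [e1, norm_mul, Circle.norm_coe, mul_one, e2]
  refine (norm_add_le _ _).trans ?_
  rw [norm_mul, Complex.norm_exp_I_mul_ofReal, mul_one, Complex.norm_real, Real.norm_eq_abs, hyn,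
    abs_of_neg (by linarith)]
  have := Real.norm_exp_I_mul_ofReal_sub_one_le (x := y.arg)
  rw [Real.norm_eq_abs] at this
  linarith

lemma mem_carlesonWindow_one {h : ℝ} (h1 : h < 1) {z : ℂ} (hz : ‖z‖ < 1)
    (hz1 : ‖z - 1‖ ≤ h / 4) : z ∈ carlesonWindow 1 h := by
  have hre : |z.re - 1| ≤ h / 4 := by
    simpa using (Complex.abs_re_le_norm (z - 1)).trans hz1
  have him : |z.im| ≤ h / 4 := by simpa using (Complex.abs_im_le_norm (z - 1)).trans hz1
  have h0 : 0 ≤ h := by linarith [abs_nonneg z.im]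
  have hre' := (abs_le.1 hre).1
  have hn : 1 - h / 4 ≤ ‖z‖ := by linarith [Complex.re_le_norm z]
  refine ⟨hz, by linarith, ?_⟩
  simp only [Circle.coe_one, map_one, mul_one]
  rw [Complex.arg_of_re_nonneg (by linarith)]
  -- The argument is arcsin(Im z / |z|). Here |Im z| ≤ h/4 and |z| ≥ 1/2, and h/2 ≤ sin h on [0, 1].
  have hq : |z.im / ‖z‖| ≤ h / 2 := by
    rw [abs_div, abs_norm, div_le_iff₀ (by linarith)]
    nlinarith
  have hs : h / 2 ≤ Real.sin h := by
    have h2 := Real.mul_le_sin h0 (by linarith [Real.pi_gt_three])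
    have h3 : (1 : ℝ) / 2 ≤ 2 / Real.pi := by
      rw [div_le_div_iff₀ (by norm_num) Real.pi_pos]; linarith [Real.pi_le_four]
    nlinarith
  rw [abs_le] at hq ⊢
  constructor
  · rw [Real.le_arcsin_iff_sin_le' ⟨by linarith [Real.pi_gt_three], by linarith [Real.pi_gt_three]⟩, Real.sin_neg]
    linarith
  · rw [Real.arcsin_le_iff_le_sin' ⟨by linarith [Real.pi_gt_three], by linarith [Real.pi_gt_three]⟩]
    linarith

lemma isTheta_carlesonFunction {μ : Measure ℂ} {p C c : ℝ} (hc : 0 < c)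
    (hup : ∀ᶠ h : ℝ in 𝓝[>] 0, ∀ ξ : Circle, μ (carlesonWindow ξ h) ≤ ENNReal.ofReal (C * h ^ p))
    (hlow : ∀ᶠ h : ℝ in 𝓝[>] 0, ENNReal.ofReal (c * h ^ p) ≤ μ (carlesonWindow 1 h)) :
    (fun h : ℝ => carlesonFunction μ h) =Θ[𝓝[>] 0] (fun h : ℝ => h ^ p) := by
  constructor
  · refine IsBigO.of_bound |C| ?_
    filter_upwards [hup, self_mem_nhdsWithin] with h h1 h0
    have hp : 0 < h ^ p := Real.rpow_pos_of_pos h0 _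
    rw [carlesonFunction, Real.norm_of_nonneg ENNReal.toReal_nonneg, Real.norm_of_nonneg hp.le]
    refine ENNReal.toReal_le_of_le_ofReal (by positivity) ((iSup_le h1).trans ?_)
    exact ENNReal.ofReal_le_ofReal (by gcongr; exact le_abs_self C)
  · refine IsBigO.of_bound c⁻¹ ?_
    filter_upwards [hup, hlow, self_mem_nhdsWithin] with h h1 h2 h0
    have hp : 0 < h ^ p := Real.rpow_pos_of_pos h0 _
    rw [carlesonFunction, Real.norm_of_nonneg ENNReal.toReal_nonneg, Real.norm_of_nonneg hp.le, ← div_eq_inv_mul,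
      le_div_iff₀ hc, mul_comm]
    -- Without finiteness `toReal` would send the supremum to 0 and the lower bound would be lost.
    have hne : (⨆ ξ : Circle, μ (carlesonWindow ξ h)) ≠ ⊤ :=
      ((iSup_le h1).trans_lt ENNReal.ofReal_lt_top).ne
    exact (ENNReal.ofReal_le_iff_le_toReal hne).1
      (h2.trans (le_iSup (fun ξ : Circle => μ (carlesonWindow ξ h)) 1))

lemma volume_le_ofReal_of_abs_sub_le {S : Set ℝ} {d : ℝ}
    (h : ∀ s ∈ S, ∀ t ∈ S, |s - t| ≤ d) : volume S ≤ ENNReal.ofReal d := by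
  refine (Real.volume_le_diam S).trans (Metric.ediam_le fun s hs t ht => ?_)
  rw [edist_dist, Real.dist_eq]
  exact ENNReal.ofReal_le_ofReal (h s hs t ht)

/-- For a symbol with real coefficients, the measures of the windows are controlled by the
subsets of the upper half circle on which the symbol varies by at most `4 * h`. -/
lemma pullbackMeasure_carlesonWindow_le {φ : ℂ → ℂ} (hm : Measurable φ)
    (hφ : ∀ ξ : Circle, (ξ : ℂ).im ≠ 0 → ContinuousAt φ ξ)
    (hconj : ∀ t ∈ Ioo 0 Real.pi, φ (Circle.exp (-t)) = (starRingEnd ℂ) (φ (Circle.exp t)))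
    {h B : ℝ} (hB : 0 ≤ B)
    (H : ∀ S ⊆ Ioo 0 Real.pi, (∀ t ∈ S, 1 - h ≤ ‖φ (Circle.exp t)‖) →
      (∀ s ∈ S, ∀ t ∈ S, ‖φ (Circle.exp s) - φ (Circle.exp t)‖ ≤ 4 * h) →
      volume S ≤ ENNReal.ofReal B) (ξ : Circle) :
    pullbackMeasure φ (carlesonWindow ξ h) ≤ ENNReal.ofReal B := by
  rw [pullbackMeasure_apply hm hφ (measurableSet_carlesonWindow ξ h)
    (carlesonWindow_subset_ball ξ h)]
  set W := carlesonWindow ξ h with hW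
  have hdist : ∀ z ∈ W, ∀ w ∈ W, ‖z - w‖ ≤ 4 * h := by
    intro z hz w hw
    have h1 := norm_sub_le_of_mem_carlesonWindow hz
    have h2 := norm_sub_le_of_mem_carlesonWindow hw
    calc ‖z - w‖ = ‖(z - ξ) - (w - ξ)‖ := by congr 1; ring
      _ ≤ 4 * h := (norm_sub_le _ _).trans (by linarith)
  set S₁ : Set ℝ := {t | t ∈ Ioo 0 Real.pi ∧ φ (Circle.exp t) ∈ W}
  set S₂ : Set ℝ := {t | t ∈ Ioo 0 Real.pi ∧ φ (Circle.exp (-t)) ∈ W}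
  have v1 : volume S₁ ≤ ENNReal.ofReal B :=
    H S₁ (fun t ht => ht.1) (fun t ht => ht.2.2.1)
      (fun s hs t ht => hdist _ hs.2 _ ht.2)
  have v2 : volume S₂ ≤ ENNReal.ofReal B := by
    refine H S₂ (fun t ht => ht.1) (fun t ht => ?_) (fun s hs t ht => ?_)
    · have := ht.2.2.1
      rwa [hconj t ht.1, Complex.norm_conj] at this
    · have := hdist _ hs.2 _ ht.2
      rwa [hconj t ht.1, hconj s hs.1, ← map_sub, Complex.norm_conj] at this
  -- The lower half circle is the reflection of the upper one; the parameters 0 and π belong to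
  -- neither and are null.
  have hsub : arcPreimage φ W ⊆ S₁ ∪ (Neg.neg ⁻¹' S₂) ∪ {0} ∪ {Real.pi} := by
    rintro t ⟨⟨ht1, ht2⟩, htW⟩
    rcases lt_trichotomy t 0 with h0 | h0 | h0
    · refine Or.inl (Or.inl (Or.inr ⟨⟨by linarith, by linarith⟩, ?_⟩))
      rwa [neg_neg]
    · exact Or.inl (Or.inr h0)
    · rcases ht2.lt_or_eq with h2 | h2
      · exact Or.inl (Or.inl (Or.inl ⟨⟨h0, h2⟩, htW⟩))
      · exact Or.inr h2
  have v3 : volume (arcPreimage φ W) ≤ ENNReal.ofReal (2 * B) := by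
    refine (measure_mono hsub).trans ((measure_union_le _ _).trans ?_)
    rw [measure_singleton, add_zero]
    refine (measure_union_le _ _).trans ?_
    rw [measure_singleton, add_zero]
    refine (measure_union_le _ _).trans ?_
    rw [Measure.measure_preimage_neg, two_mul, ENNReal.ofReal_add hB hB]
    exact add_le_add v1 v2
  calc _ ≤ ENNReal.ofReal (2 * Real.pi)⁻¹ * ENNReal.ofReal (2 * B) := by gcongr
    _ = ENNReal.ofReal ((2 * Real.pi)⁻¹ * (2 * B)) := by
      exact (ENNReal.ofReal_mul (by positivity)).symm
    _ ≤ ENNReal.ofReal B := by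
      apply ENNReal.ofReal_le_ofReal
      rw [inv_mul_le_iff₀ (by positivity)]
      nlinarith [Real.pi_gt_three]

lemma le_pullbackMeasure_carlesonWindow {φ : ℂ → ℂ} (hm : Measurable φ)
    (hφ : ∀ ξ : Circle, (ξ : ℂ).im ≠ 0 → ContinuousAt φ ξ) {h u v : ℝ} (h1 : h < 1)
    (hu : 0 ≤ u) (hv : v ≤ Real.pi)
    (H : ∀ t ∈ Ioo u v, ‖φ (Circle.exp t)‖ < 1 ∧ ‖φ (Circle.exp t) - 1‖ ≤ h / 4) :
    ENNReal.ofReal ((2 * Real.pi)⁻¹ * (v - u)) ≤ pullbackMeasure φ (carlesonWindow 1 h) := by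
  rw [pullbackMeasure_apply hm hφ (measurableSet_carlesonWindow 1 h)
    (carlesonWindow_subset_ball 1 h), ENNReal.ofReal_mul (by positivity), ← Real.volume_Ioo]
  gcongr
  intro t ht
  exact ⟨⟨by linarith [ht.1, Real.pi_pos], by linarith [ht.2]⟩,
    mem_carlesonWindow_one h1 (H t ht).1 (H t ht).2⟩

/-! ### The two symbols on the disc -/

/-- The Cayley transform of the disc onto the right half-plane. -/
def cayley (z : ℂ) : ℂ := (1 + z) / (1 - z)

/-- A symbol touching the unit circle at `1` (smoothly) and at `-1` (with a corner). -/
def outerSymbol (a b : ℝ) (z : ℂ) : ℂ := halfPlaneSymbol a b (cayley z)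

/-- The product of `outerSymbol` with the atomic singular inner function. -/
def twistedSymbol (a b : ℝ) (z : ℂ) : ℂ := outerSymbol a b z * Complex.exp (-cayley z)

lemma cayley_re {z : ℂ} (hz : z ≠ 1) : (cayley z).re = (1 - ‖z‖ ^ 2) / ‖1 - z‖ ^ 2 := by
  have h : (1 - z) ≠ 0 := sub_ne_zero.2 hz.symm
  rw [cayley, Complex.div_re, ← Complex.normSq_eq_norm_sq, ← Complex.normSq_eq_norm_sq,
    ← add_div]
  congr 1
  simp [Complex.normSq_apply]
  ring

lemma cayley_re_nonneg {z : ℂ} (hz : ‖z‖ ≤ 1) (h1 : z ≠ 1) : 0 ≤ (cayley z).re := by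
  rw [cayley_re h1]
  have : ‖z‖ ^ 2 ≤ 1 := pow_le_one₀ (norm_nonneg z) hz
  exact div_nonneg (by linarith) (by positivity)

lemma cayley_ne_zero {z : ℂ} (h1 : z ≠ 1) (h2 : z ≠ -1) : cayley z ≠ 0 := by
  refine div_ne_zero ?_ (sub_ne_zero.2 h1.symm)
  rw [add_comm]
  exact fun h => h2 (eq_neg_of_add_eq_zero_left h)

/-- The closed right half-plane minus the origin avoids the branch cut, which makes the symbols
differentiable in the full sense at boundary points other than ±1. -/
lemma mem_slitPlane_of_re_nonneg {w : ℂ} (h : 0 ≤ w.re) (h0 : w ≠ 0) : w ∈ Complex.slitPlane := by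
  rcases h.lt_or_eq with h | h
  · exact Or.inl h
  · exact Or.inr fun hi => h0 (Complex.ext h.symm hi)

lemma differentiableAt_cayley {z : ℂ} (h1 : z ≠ 1) : DifferentiableAt ℂ cayley z :=
  ((differentiableAt_const _).add differentiableAt_id).div
    ((differentiableAt_const _).sub differentiableAt_id) (sub_ne_zero.2 h1.symm)

lemma differentiableAt_halfPlaneSymbol {a b : ℝ} (ha : |a| < 1) (hb : |b| < 1) {w : ℂ}
    (hw : 0 ≤ w.re) (h0 : w ≠ 0) : DifferentiableAt ℂ (halfPlaneSymbol a b) w := by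
  have hs := mem_slitPlane_of_re_nonneg hw h0
  have hg : DifferentiableAt ℂ (powerSum a b) w :=
    (differentiableAt_id.add (differentiableAt_id.cpow (differentiableAt_const _) hs)).add
      (differentiableAt_id.cpow (differentiableAt_const _) hs)
  exact (hg.sub (differentiableAt_const _)).div (hg.add (differentiableAt_const _))
    (add_one_ne_zero_of_re_pos (powerSum_re_pos ha hb hw h0))

lemma ne_one_of_im_ne_zero {z : ℂ} (h : z.im ≠ 0) : z ≠ 1 := by rintro rfl; simp at h

lemma ne_neg_one_of_im_ne_zero {z : ℂ} (h : z.im ≠ 0) : z ≠ -1 := by rintro rfl; simp at h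

section Symbols

variable {a b : ℝ}

lemma differentiableAt_outerSymbol (ha : |a| < 1) (hb : |b| < 1) {z : ℂ} (hz : ‖z‖ ≤ 1)
    (h1 : z ≠ 1) (h2 : z ≠ -1) : DifferentiableAt ℂ (outerSymbol a b) z :=
  (differentiableAt_halfPlaneSymbol ha hb (cayley_re_nonneg hz h1) (cayley_ne_zero h1 h2)).comp z
    (differentiableAt_cayley h1)

lemma differentiableAt_twistedSymbol (ha : |a| < 1) (hb : |b| < 1) {z : ℂ} (hz : ‖z‖ ≤ 1)
    (h1 : z ≠ 1) (h2 : z ≠ -1) : DifferentiableAt ℂ (twistedSymbol a b) z :=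
  (differentiableAt_outerSymbol ha hb hz h1 h2).mul (differentiableAt_cayley h1).neg.cexp

lemma norm_outerSymbol_lt_one (ha : |a| < 1) (hb : |b| < 1) {z : ℂ} (hz : ‖z‖ ≤ 1)
    (h1 : z ≠ 1) (h2 : z ≠ -1) : ‖outerSymbol a b z‖ < 1 :=
  norm_div_lt_one (powerSum_re_pos ha hb (cayley_re_nonneg hz h1) (cayley_ne_zero h1 h2))

lemma norm_twistedSymbol_lt_one (ha : |a| < 1) (hb : |b| < 1) {z : ℂ} (hz : ‖z‖ ≤ 1)
    (h1 : z ≠ 1) (h2 : z ≠ -1) : ‖twistedSymbol a b z‖ < 1 := by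
  rw [twistedSymbol, norm_mul, Complex.norm_exp]
  have h3 : Real.exp ((-cayley z).re) ≤ 1 := by
    rw [Real.exp_le_one_iff, Complex.neg_re]
    linarith [cayley_re_nonneg hz h1]
  have h4 := norm_outerSymbol_lt_one ha hb hz h1 h2
  exact (mul_le_of_le_one_right (norm_nonneg _) h3).trans_lt h4

/-- The Cayley image of the circle is the imaginary axis, where e^{-w} is unimodular. -/
lemma norm_twistedSymbol_circle {ξ : Circle} (h1 : (ξ : ℂ) ≠ 1) :
    ‖twistedSymbol a b ξ‖ = ‖outerSymbol a b ξ‖ := by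
  rw [twistedSymbol, norm_mul, Complex.norm_exp, Complex.neg_re, cayley_re h1, Circle.norm_coe]
  simp

lemma isSymbol_of_differentiableAt {φ : ℂ → ℂ}
    (hd : ∀ z : ℂ, ‖z‖ ≤ 1 → z ≠ 1 → z ≠ -1 → DifferentiableAt ℂ φ z)
    (hn : ∀ z : ℂ, ‖z‖ ≤ 1 → z ≠ 1 → z ≠ -1 → ‖φ z‖ < 1) : IsSymbol φ := by
  have h1 : ∀ z ∈ Metric.ball (0 : ℂ) 1, ‖z‖ ≤ 1 ∧ z ≠ 1 ∧ z ≠ -1 := by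
    intro z hz
    rw [mem_ball_zero_iff] at hz
    refine ⟨hz.le, ?_, ?_⟩ <;> rintro rfl <;> simp at hz
  refine ⟨fun z hz => ?_, fun z hz => ?_, ?_⟩
  · obtain ⟨h, h', h''⟩ := h1 z hz
    exact (hd z h h' h'').differentiableWithinAt
  · obtain ⟨h, h', h''⟩ := h1 z hz
    exact mem_ball_zero_iff.2 (hn z h h' h'')
  · filter_upwards [ae_circleMeasure_im_ne_zero] with ξ hξ
    have h' := ne_one_of_im_ne_zero hξ
    have h'' := ne_neg_one_of_im_ne_zero hξ
    exact ⟨φ ξ, hn ξ (Circle.norm_coe ξ).le h' h'',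
      hasRadialLimit_of_continuousAt (hd ξ (Circle.norm_coe ξ).le h' h'').continuousAt⟩

lemma measurable_cayley : Measurable cayley :=
  (measurable_const.add measurable_id).div (measurable_const.sub measurable_id)

lemma measurable_outerSymbol : Measurable (outerSymbol a b) := by
  have hg : Measurable (powerSum a b) :=
    (measurable_id.add (measurable_id.pow_const _)).add (measurable_id.pow_const _)
  exact ((hg.sub_const 1).div (hg.add_const 1)).comp measurable_cayley

lemma measurable_twistedSymbol : Measurable (twistedSymbol a b) :=
  measurable_outerSymbol.mul (Complex.measurable_exp.comp measurable_cayley.neg)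

lemma cayley_conj (z : ℂ) : cayley ((starRingEnd ℂ) z) = (starRingEnd ℂ) (cayley z) := by
  simp [cayley]

lemma cpow_ofReal_conj {w : ℂ} (hw : w ∈ Complex.slitPlane) (p : ℝ) :
    ((starRingEnd ℂ) w) ^ (p : ℂ) = (starRingEnd ℂ) (w ^ (p : ℂ)) := by
  have := Complex.cpow_conj w (p : ℂ) (Complex.mem_slitPlane_iff_arg.1 hw).1
  rw [Complex.conj_ofReal] at this
  rw [this, Complex.conj_conj]

lemma halfPlaneSymbol_conj {w : ℂ} (hw : w ∈ Complex.slitPlane) :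
    halfPlaneSymbol a b ((starRingEnd ℂ) w) = (starRingEnd ℂ) (halfPlaneSymbol a b w) := by
  simp only [halfPlaneSymbol, powerSum, cpow_ofReal_conj hw, map_div₀, map_add, map_sub, map_one]

lemma outerSymbol_conj {z : ℂ} (hz : ‖z‖ ≤ 1) (h1 : z ≠ 1) (h2 : z ≠ -1) :
    outerSymbol a b ((starRingEnd ℂ) z) = (starRingEnd ℂ) (outerSymbol a b z) := by
  rw [outerSymbol, outerSymbol, cayley_conj, halfPlaneSymbol_conj
    (mem_slitPlane_of_re_nonneg (cayley_re_nonneg hz h1) (cayley_ne_zero h1 h2))]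

lemma twistedSymbol_conj {z : ℂ} (hz : ‖z‖ ≤ 1) (h1 : z ≠ 1) (h2 : z ≠ -1) :
    twistedSymbol a b ((starRingEnd ℂ) z) = (starRingEnd ℂ) (twistedSymbol a b z) := by
  rw [twistedSymbol, twistedSymbol, outerSymbol_conj hz h1 h2, cayley_conj, map_mul,
    ← Complex.exp_conj, map_neg]

/-! ### The half-cotangent coordinate on the upper half circle -/

lemma coe_exp_neg (t : ℝ) :
    (Circle.exp (-t) : ℂ) = (starRingEnd ℂ) (Circle.exp t : ℂ) := by
  rw [Circle.exp_neg, Circle.coe_inv_eq_conj]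

lemma coe_exp_im_ne_zero {t : ℝ} (ht : t ∈ Ioo 0 Real.pi) : (Circle.exp t : ℂ).im ≠ 0 := by
  rw [Circle.coe_exp, Complex.exp_ofReal_mul_I_im]
  exact (Real.sin_pos_of_pos_of_lt_pi ht.1 ht.2).ne'

/-- The image of `exp (i t)` under the Cayley transform is `halfCot t * i`. -/
def halfCot (t : ℝ) : ℝ := Real.cos (t / 2) / Real.sin (t / 2)

lemma sin_half_pos {t : ℝ} (ht : t ∈ Ioo 0 Real.pi) : 0 < Real.sin (t / 2) :=
  Real.sin_pos_of_pos_of_lt_pi (by linarith [ht.1]) (by linarith [ht.2, Real.pi_pos])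

lemma cos_half_pos {t : ℝ} (ht : t ∈ Ioo 0 Real.pi) : 0 < Real.cos (t / 2) :=
  Real.cos_pos_of_mem_Ioo ⟨by linarith [ht.1, Real.pi_pos], by linarith [ht.2]⟩

lemma halfCot_pos {t : ℝ} (ht : t ∈ Ioo 0 Real.pi) : 0 < halfCot t :=
  div_pos (cos_half_pos ht) (sin_half_pos ht)

lemma cayley_exp {t : ℝ} (ht : t ∈ Ioo 0 Real.pi) :
    cayley (Circle.exp t) = halfCot t * Complex.I := by
  have hs : (Real.sin (t / 2) : ℂ) ≠ 0 := by exact_mod_cast (sin_half_pos ht).ne'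
  have h1 := ne_one_of_im_ne_zero (coe_exp_im_ne_zero ht)
  have e : (Circle.exp t : ℂ) =
      ((Real.cos (t / 2) : ℂ) + Real.sin (t / 2) * Complex.I) ^ 2 := by
    rw [Circle.coe_exp, Complex.ofReal_cos, Complex.ofReal_sin, ← Complex.exp_mul_I,
      ← Complex.exp_nat_mul]
    push_cast
    ring_nf
  have hcs : (Real.cos (t / 2) : ℂ) ^ 2 + (Real.sin (t / 2) : ℂ) ^ 2 = 1 := by
    exact_mod_cast Real.cos_sq_add_sin_sq (t / 2)
  rw [cayley, div_eq_iff (sub_ne_zero.2 h1.symm), halfCot, Complex.ofReal_div, e,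
    div_mul_eq_mul_div, div_mul_eq_mul_div, eq_div_iff hs]
  linear_combination
    (Complex.I * Real.cos (t / 2) - Real.sin (t / 2) : ℂ) * hcs +
      (Real.sin (t / 2) : ℂ) * (Real.sin (t / 2) ^ 2 + 2 * Real.cos (t / 2) ^ 2 +
        Complex.I * Real.cos (t / 2) * Real.sin (t / 2)) * Complex.I_sq

/-- The quotient on the right is |tan(s/2) - tan(t/2)| = |sin((t-s)/2)| / (cos(s/2) cos(t/2)), which
is at least |sin((t-s)/2)|; Jordan's inequality then applies. This is the discrete form of dt =
O(dx/x²). -/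
lemma abs_sub_le_halfCot {s t : ℝ} (hs : s ∈ Ioo 0 Real.pi) (ht : t ∈ Ioo 0 Real.pi) :
    |s - t| ≤ Real.pi * (|halfCot s - halfCot t| / (halfCot s * halfCot t)) := by
  have s1 := sin_half_pos hs
  have s2 := sin_half_pos ht
  have c1 := cos_half_pos hs
  have c2 := cos_half_pos ht
  have e : halfCot s - halfCot t =
      Real.sin (t / 2 - s / 2) / (Real.sin (s / 2) * Real.sin (t / 2)) := by
    rw [halfCot, halfCot, Real.sin_sub]
    field_simp
  have e2 : |halfCot s - halfCot t| / (halfCot s * halfCot t) =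
      |Real.sin (t / 2 - s / 2)| / (Real.cos (s / 2) * Real.cos (t / 2)) := by
    rw [e, abs_div, abs_of_pos (mul_pos s1 s2), halfCot, halfCot]
    field_simp
  have h1 : |Real.sin (t / 2 - s / 2)| ≤
      |Real.sin (t / 2 - s / 2)| / (Real.cos (s / 2) * Real.cos (t / 2)) := by
    rw [le_div_iff₀ (mul_pos c1 c2)]
    exact mul_le_of_le_one_right (abs_nonneg _)
      (mul_le_one₀ (Real.cos_le_one _) c2.le (Real.cos_le_one _))
  have h2 : 2 / Real.pi * |t / 2 - s / 2| ≤ |Real.sin (t / 2 - s / 2)| :=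
    Real.mul_abs_le_abs_sin (by rw [abs_le]; constructor <;> linarith [hs.1, hs.2, ht.1, ht.2])
  rw [e2]
  have h3 : |s - t| = Real.pi * (2 / Real.pi * |t / 2 - s / 2|) := by
    rw [← mul_assoc, mul_div_cancel₀ _ Real.pi_pos.ne', ← sub_div, abs_div, abs_two, abs_sub_comm]
    ring
  rw [h3]
  gcongr
  exact h2.trans h1

lemma pi_sub_le_halfCot {t : ℝ} (ht : t ∈ Ioo 0 Real.pi) : Real.pi - t ≤ 2 * halfCot t := by
  have e : halfCot t = Real.tan ((Real.pi - t) / 2) := by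
    have : (Real.pi - t) / 2 = Real.pi / 2 - t / 2 := by ring
    rw [Real.tan_eq_sin_div_cos, this, Real.sin_pi_div_two_sub, Real.cos_pi_div_two_sub, halfCot]
  have := Real.le_tan (x := (Real.pi - t) / 2) (by linarith [ht.2]) (by linarith [ht.1])
  linarith

lemma halfCot_le_pi_sub {t : ℝ} (ht : t ∈ Ioo 0 Real.pi) (h1 : Real.pi - t ≤ 1) :
    halfCot t ≤ Real.pi - t := by
  have hs : 1 / 2 ≤ Real.sin (t / 2) := by
    have := Real.mul_le_sin (x := t / 2) (by linarith [ht.1]) (by linarith [ht.2])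
    refine le_trans ?_ this
    rw [div_mul_div_comm, div_le_div_iff₀ (by norm_num) (by linarith [Real.pi_pos])]
    linarith [Real.pi_gt_three]
  have hc : Real.cos (t / 2) ≤ (Real.pi - t) / 2 := by
    rw [← Real.sin_pi_div_two_sub]
    exact (Real.sin_le (by linarith [ht.2])).trans (by linarith)
  rw [halfCot, div_le_iff₀ (by linarith)]
  nlinarith [ht.2]

lemma inv_le_halfCot {t : ℝ} (ht : t ∈ Ioo 0 1) : t⁻¹ ≤ halfCot t := by
  have h0 := ht.1
  have hc : 1 / 2 ≤ Real.cos (t / 2) := by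
    have := Real.one_sub_sq_div_two_le_cos (x := t / 2)
    nlinarith [ht.2]
  have hs : Real.sin (t / 2) ≤ t / 2 := Real.sin_le (by linarith)
  have hs0 := sin_half_pos (t := t) ⟨h0, by linarith [ht.2, Real.pi_gt_three]⟩
  rw [halfCot, inv_eq_one_div, div_le_div_iff₀ h0 hs0]
  nlinarith

lemma outerSymbol_exp {t : ℝ} (ht : t ∈ Ioo 0 Real.pi) :
    outerSymbol a b (Circle.exp t) = halfPlaneSymbol a b (halfCot t * Complex.I) := by
  rw [outerSymbol, cayley_exp ht]

lemma twistedSymbol_exp {t : ℝ} (ht : t ∈ Ioo 0 Real.pi) :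
    twistedSymbol a b (Circle.exp t) = halfPlaneSymbol a b (halfCot t * Complex.I) *
      Complex.exp (-(halfCot t * Complex.I)) := by
  rw [twistedSymbol, outerSymbol_exp ht, cayley_exp ht]

end Symbols

/-! ### Measure of parameter sets described by the half cotangent -/

lemma volume_le_of_halfCot_le {S : Set ℝ} (hS : S ⊆ Ioo 0 Real.pi) {D : ℝ}
    (h : ∀ t ∈ S, halfCot t ≤ D) : volume S ≤ ENNReal.ofReal (2 * D) := by
  have hsub : S ⊆ Icc (Real.pi - 2 * D) Real.pi := fun t ht =>
    ⟨by linarith [pi_sub_le_halfCot (hS ht), h t ht], (hS ht).2.le⟩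
  refine (measure_mono hsub).trans (le_of_eq ?_)
  rw [Real.volume_Icc]
  congr 1
  ring

lemma sum_range_inv_sq_le {X : ℝ} (hX : 2 ≤ X) (n : ℕ) :
    ∑ k ∈ Finset.range n, ((X + k) ^ 2)⁻¹ ≤ 2 / X := by
  have key : ∑ k ∈ Finset.range n, ((X + k) ^ 2)⁻¹ ≤ (X - 1)⁻¹ - (X - 1 + n)⁻¹ := by
    induction n with
    | zero => simp
    | succ n ih =>
      rw [Finset.sum_range_succ]
      have hn : (0 : ℝ) ≤ n := n.cast_nonneg
      -- Telescoping comparison; X ≥ 2 later gives 1/(X-1) ≤ 2/X.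
      have h1 : ((X + n) ^ 2)⁻¹ ≤ (X - 1 + n)⁻¹ - (X + n)⁻¹ := by
        rw [inv_sub_inv (by linarith) (by linarith), inv_eq_one_div,
          div_le_div_iff₀ (by positivity) (by nlinarith)]
        nlinarith
      have h2 : X - 1 + ((n + 1 : ℕ) : ℝ) = X + n := by push_cast; ring
      rw [h2]
      linarith
  have h3 : 0 ≤ (X - 1 + n)⁻¹ := inv_nonneg.2 (by linarith [n.cast_nonneg (α := ℝ)])
  have h4 : (X - 1)⁻¹ ≤ 2 / X := by
    rw [inv_eq_one_div, div_le_div_iff₀ (by linarith) (by linarith)]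
    linarith
  linarith

/-- A set of arc parameters with large half cotangents is small if, at unit scale, the half
cotangents concentrate in intervals of length `d`. -/
lemma volume_le_of_halfCot_locally {S : Set ℝ} (hS : S ⊆ Ioo 0 Real.pi) {X d : ℝ} (hX : 2 ≤ X)
    (hd : 0 ≤ d) (hXS : ∀ t ∈ S, X ≤ halfCot t)
    (hloc : ∀ s ∈ S, ∀ t ∈ S, |halfCot s - halfCot t| ≤ 1 → |halfCot s - halfCot t| ≤ d) :
    volume S ≤ ENNReal.ofReal (Real.pi * d * (2 / X)) := by
  -- Slices of unit length in the half cotangent: each has t-diameter at most πd/(X+n)², and these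
  -- bounds are summed.
  set T : ℕ → Set ℝ := fun n => {t | t ∈ S ∧ X + n ≤ halfCot t ∧ halfCot t < X + n + 1}
  have hcov : S ⊆ ⋃ n, T n := by
    intro t ht
    have h0 : 0 ≤ halfCot t - X := by linarith [hXS t ht]
    refine mem_iUnion.2 ⟨⌊halfCot t - X⌋₊, ht, ?_, ?_⟩
    · linarith [Nat.floor_le h0]
    · linarith [Nat.lt_floor_add_one (halfCot t - X)]
  have hvol : ∀ n, volume (T n) ≤ ENNReal.ofReal (Real.pi * d * ((X + n) ^ 2)⁻¹) := by
    intro n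
    refine volume_le_ofReal_of_abs_sub_le fun s hs t ht => ?_
    have hn : (0 : ℝ) ≤ n := n.cast_nonneg
    have h1 : |halfCot s - halfCot t| ≤ d := by
      refine hloc s hs.1 t ht.1 ?_
      rw [abs_le]
      constructor <;> linarith [hs.2.1, hs.2.2, ht.2.1, ht.2.2]
    refine (abs_sub_le_halfCot (hS hs.1) (hS ht.1)).trans ?_
    rw [mul_assoc, ← div_eq_mul_inv, sq]
    have h2 := hs.2.1
    have h3 := ht.2.1
    have h4 : 0 < X + n := by linarith
    have h5 : 0 < halfCot s := h4.trans_le h2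
    gcongr
  refine (measure_mono hcov).trans ((measure_iUnion_le _).trans
    (ENNReal.tsum_le_of_sum_range_le fun n => ?_))
  calc ∑ k ∈ Finset.range n, volume (T k)
      ≤ ∑ k ∈ Finset.range n, ENNReal.ofReal (Real.pi * d * ((X + k) ^ 2)⁻¹) :=
        Finset.sum_le_sum fun k _ => hvol k
    _ = ENNReal.ofReal (∑ k ∈ Finset.range n, Real.pi * d * ((X + k) ^ 2)⁻¹) :=
        (ENNReal.ofReal_sum_of_nonneg fun k _ => by positivity).symm
    _ ≤ ENNReal.ofReal (Real.pi * d * (2 / X)) := by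
        rw [← Finset.mul_sum]
        apply ENNReal.ofReal_le_ofReal
        gcongr
        exact sum_range_inv_sq_le hX n

/-! ### Order of the two Carleson functions -/

section Estimates

variable {a b : ℝ}

lemma abs_lt_one_of_mem_Ioo (ha : a ∈ Ioo (0 : ℝ) 1) : |a| < 1 := by
  rw [abs_of_pos ha.1]; exact ha.2

/-- The part of the windows coming from the corner at `-1`. -/
lemma volume_corner_le (ha : a ∈ Ioo (0 : ℝ) 1) (hb : b ∈ Ioo (0 : ℝ) 1) {h : ℝ} (hh : 0 < h)
    (h1 : h < 1) {S : Set ℝ} (hS : S ⊆ Ioo 0 Real.pi)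
    (hle : ∀ t ∈ S, 1 - h ≤ ‖outerSymbol a b (Circle.exp t)‖) :
    volume {t | t ∈ S ∧ halfCot t ≤ 1} ≤
      ENNReal.ofReal (2 * ((8 / Real.cos (Real.pi / 2 * b)) ^ b⁻¹ * h ^ b⁻¹)) := by
  refine volume_le_of_halfCot_le (fun t ht => hS ht.1) fun t ht => ?_
  have := hle t ht.1
  rw [outerSymbol_exp (hS ht.1)] at this
  exact rpow_le_of_one_sub_le ha hb (halfCot_pos (hS ht.1)) ht.2 hh h1 this

lemma volume_le_of_split {S : Set ℝ} {A B : ℝ} (hA : 0 ≤ A) (hB : 0 ≤ B)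
    (h1 : volume {t | t ∈ S ∧ halfCot t ≤ 1} ≤ ENNReal.ofReal A)
    (h2 : volume {t | t ∈ S ∧ 1 < halfCot t} ≤ ENNReal.ofReal B) :
    volume S ≤ ENNReal.ofReal (A + B) := by
  have : S ⊆ {t | t ∈ S ∧ halfCot t ≤ 1} ∪ {t | t ∈ S ∧ 1 < halfCot t} := fun t ht =>
    (le_or_gt (halfCot t) 1).imp (fun h => ⟨ht, h⟩) (fun h => ⟨ht, h⟩)
  rw [ENNReal.ofReal_add hA hB]
  exact (measure_mono this).trans ((measure_union_le _ _).trans (add_le_add h1 h2))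

/-- The corner gives h^{1/b} ≤ h. Where x > 1, distances between values of the symbol dominate a
multiple of |s - t|, so a set on which it varies by at most 4h has diameter O(h), whatever the
modulus. -/
lemma exists_volume_outerSymbol_le (ha : a ∈ Ioo (0 : ℝ) 1) (hb : b ∈ Ioo (0 : ℝ) 1) :
    ∃ C : ℝ, 0 ≤ C ∧ ∀ h ∈ Ioo (0 : ℝ) 1, ∀ S ⊆ Ioo 0 Real.pi,
      (∀ t ∈ S, 1 - h ≤ ‖outerSymbol a b (Circle.exp t)‖) →
      (∀ s ∈ S, ∀ t ∈ S,
        ‖outerSymbol a b (Circle.exp s) - outerSymbol a b (Circle.exp t)‖ ≤ 4 * h) →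
      volume S ≤ ENNReal.ofReal (C * h) := by
  have hc := cos_half_pi_mul_pos hb
  set K := (8 / Real.cos (Real.pi / 2 * b)) ^ b⁻¹ with hK
  have hK0 : 0 ≤ K := by positivity
  refine ⟨2 * K + 32 * Real.pi, by positivity, fun h hh S hS hle hdist => ?_⟩
  have h0 := hh.1
  have hpow : h ^ b⁻¹ ≤ h :=
    Real.rpow_le_self_of_le_one h0.le hh.2.le ((one_le_inv₀ hb.1).2 hb.2.le)
  refine (volume_le_of_split (by positivity) (by positivity : 0 ≤ 32 * Real.pi * h)
    (volume_corner_le ha hb h0 hh.2 hS hle) ?_).trans (ENNReal.ofReal_le_ofReal ?_)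
  · refine volume_le_ofReal_of_abs_sub_le fun s hs t ht => ?_
    have h2 := hdist s hs.1 t ht.1
    rw [outerSymbol_exp (hS hs.1), outerSymbol_exp (hS ht.1)] at h2
    have h3 := abs_sub_div_le_norm_halfPlaneSymbol_sub ha hb hs.2.le ht.2.le
    calc |s - t| ≤ Real.pi * (|halfCot s - halfCot t| / (halfCot s * halfCot t)) :=
          abs_sub_le_halfCot (hS hs.1) (hS ht.1)
      _ ≤ Real.pi * (32 * h) := by gcongr; linarith
      _ = 32 * Real.pi * h := by ring
  · rw [← hK]
    nlinarith

/-- The modulus condition, insensitive to the inner factor, confines x to the corner or to x ≥ X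
with X of order h^{-1/(2-a)}. In the second range the rotation leaves O(h/X), and `hab` is what
makes this O(h^{1/b}). -/
lemma exists_volume_twistedSymbol_le (ha : a ∈ Ioo (0 : ℝ) 1) (hb : b ∈ Ioo (0 : ℝ) 1)
    (hab : b⁻¹ ≤ 1 + (2 - a)⁻¹) :
    ∃ C : ℝ, 0 ≤ C ∧ ∀ᶠ h : ℝ in 𝓝[>] 0, ∀ S ⊆ Ioo 0 Real.pi,
      (∀ t ∈ S, 1 - h ≤ ‖twistedSymbol a b (Circle.exp t)‖) →
      (∀ s ∈ S, ∀ t ∈ S,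
        ‖twistedSymbol a b (Circle.exp s) - twistedSymbol a b (Circle.exp t)‖ ≤ 4 * h) →
      volume S ≤ ENNReal.ofReal (C * h ^ b⁻¹) := by
  have hc := cos_half_pi_mul_pos hb
  have hca := cos_half_pi_mul_pos ha
  set K := (8 / Real.cos (Real.pi / 2 * b)) ^ b⁻¹ with hK
  have hK0 : 0 ≤ K := by positivity
  set q := (2 - a)⁻¹ with hq
  have hq0 : 0 < q := inv_pos.2 (by linarith [ha.2])
  set c := (Real.cos (Real.pi / 2 * a) / 8) ^ q with hcdef
  have hc0 : 0 < c := by positivity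
  refine ⟨2 * K + 40 * Real.pi / c, by positivity, ?_⟩
  have hlarge : ∀ᶠ h : ℝ in 𝓝[>] 0, 20 ≤ c * h ^ (-q) :=
    ((tendsto_rpow_neg_nhdsGT_zero (neg_neg_of_pos hq0)).const_mul_atTop hc0).eventually_ge_atTop 20
  -- The conditions X ≥ 20 and h < 1/2 supply the hypotheses of `abs_sub_le_norm_mul_exp_sub`; its
  -- factor 5 and the variation 4h give d = 20h below.
  filter_upwards [hlarge, Ioo_mem_nhdsGT (show (0 : ℝ) < 1 / 2 by norm_num)]
    with h hX hh S hS hle hdist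
  have h0 := hh.1
  have h1 : h < 1 := by linarith [hh.2]
  have hle' : ∀ t ∈ S, 1 - h ≤ ‖outerSymbol a b (Circle.exp t)‖ := fun t ht => by
    rw [← norm_twistedSymbol_circle (ne_one_of_im_ne_zero (coe_exp_im_ne_zero (hS ht)))]
    exact hle t ht
  set X := c * h ^ (-q) with hXdef
  refine (volume_le_of_split (B := Real.pi * (20 * h) * (2 / X)) (by positivity) (by positivity)
    (volume_corner_le ha hb h0 h1 hS hle') ?_).trans (ENNReal.ofReal_le_ofReal ?_)
  · have hmod : ∀ t ∈ {t | t ∈ S ∧ 1 < halfCot t},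
        1 - h ≤ ‖halfPlaneSymbol a b (halfCot t * Complex.I)‖ := fun t ht => by
      rw [← outerSymbol_exp (hS ht.1)]
      exact hle' t ht.1
    have hXle : ∀ t ∈ {t | t ∈ S ∧ 1 < halfCot t}, X ≤ halfCot t := fun t ht =>
      le_of_one_sub_le ha hb ht.2.le h0 h1 (hmod t ht)
    refine volume_le_of_halfCot_locally (fun t ht => hS ht.1) (by linarith) (by positivity) hXle
      fun s hs t ht hst => ?_
    have h2 := hdist s hs.1 t ht.1
    rw [twistedSymbol_exp (hS hs.1), twistedSymbol_exp (hS ht.1)] at h2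
    have h3 := abs_sub_le_norm_mul_exp_sub ha hb (hX.trans (hXle s hs)) (hX.trans (hXle t ht)) hst
      (by linarith [hmod s hs, hh.2])
    linarith
  · have e : Real.pi * (20 * h) * (2 / X) = 40 * Real.pi / c * h ^ (1 + q) := by
      rw [hXdef, Real.rpow_neg h0.le, Real.rpow_add h0, Real.rpow_one]
      have : h ^ q ≠ 0 := by positivity
      field_simp
      ring
    have hpow : h ^ (1 + q) ≤ h ^ b⁻¹ := Real.rpow_le_rpow_of_exponent_ge h0 h1.le hab
    rw [e, ← hK, add_mul, mul_assoc 2]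
    gcongr

lemma continuousAt_outerSymbol (ha : a ∈ Ioo (0 : ℝ) 1) (hb : b ∈ Ioo (0 : ℝ) 1) (ξ : Circle)
    (hξ : (ξ : ℂ).im ≠ 0) : ContinuousAt (outerSymbol a b) ξ :=
  (differentiableAt_outerSymbol (abs_lt_one_of_mem_Ioo ha) (abs_lt_one_of_mem_Ioo hb)
    (Circle.norm_coe ξ).le (ne_one_of_im_ne_zero hξ) (ne_neg_one_of_im_ne_zero hξ)).continuousAt

lemma continuousAt_twistedSymbol (ha : a ∈ Ioo (0 : ℝ) 1) (hb : b ∈ Ioo (0 : ℝ) 1) (ξ : Circle)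
    (hξ : (ξ : ℂ).im ≠ 0) : ContinuousAt (twistedSymbol a b) ξ :=
  (differentiableAt_twistedSymbol (abs_lt_one_of_mem_Ioo ha) (abs_lt_one_of_mem_Ioo hb)
    (Circle.norm_coe ξ).le (ne_one_of_im_ne_zero hξ) (ne_neg_one_of_im_ne_zero hξ)).continuousAt

theorem isTheta_carlesonFunction_outerSymbol (ha : a ∈ Ioo (0 : ℝ) 1) (hb : b ∈ Ioo (0 : ℝ) 1) :
    (fun h : ℝ => carlesonFunction (pullbackMeasure (outerSymbol a b)) h) =Θ[𝓝[>] 0]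
      (fun h : ℝ => h) := by
  have ha' := abs_lt_one_of_mem_Ioo ha
  have hb' := abs_lt_one_of_mem_Ioo hb
  obtain ⟨C, hC, hup⟩ := exists_volume_outerSymbol_le ha hb
  have key : (fun h : ℝ => carlesonFunction (pullbackMeasure (outerSymbol a b)) h) =Θ[𝓝[>] 0]
      (fun h : ℝ => h ^ (1 : ℝ)) := by
    refine isTheta_carlesonFunction (C := C) (c := (2 * Real.pi)⁻¹ * (1 / 16)) (by positivity) ?_ ?_
    · filter_upwards [Ioo_mem_nhdsGT (show (0 : ℝ) < 1 by norm_num)] with h hh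
      rw [Real.rpow_one]
      refine pullbackMeasure_carlesonWindow_le measurable_outerSymbol
        (continuousAt_outerSymbol ha hb) (fun t ht => ?_) (mul_nonneg hC hh.1.le) (hup h hh)
      have him := coe_exp_im_ne_zero ht
      rw [coe_exp_neg, outerSymbol_conj (Circle.norm_coe _).le (ne_one_of_im_ne_zero him)
        (ne_neg_one_of_im_ne_zero him)]
    · filter_upwards [Ioo_mem_nhdsGT (show (0 : ℝ) < 1 by norm_num)] with h hh
      have h0 := hh.1
      -- For t < h/16 one has x ≥ 1/t ≥ 16/h, so |φ₁ - 1| ≤ 4/x ≤ h/4.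
      have := le_pullbackMeasure_carlesonWindow measurable_outerSymbol
        (continuousAt_outerSymbol ha hb) (u := 0) (v := h / 16) hh.2 le_rfl
        (by linarith [hh.2, Real.pi_gt_three]) (fun t ht => ?_)
      · convert this using 2
        rw [Real.rpow_one]
        ring
      · have ht' : t ∈ Ioo 0 Real.pi := ⟨ht.1, by linarith [ht.2, hh.2, Real.pi_gt_three]⟩
        have him := coe_exp_im_ne_zero ht'
        refine ⟨norm_outerSymbol_lt_one ha' hb' (Circle.norm_coe _).le (ne_one_of_im_ne_zero him)
          (ne_neg_one_of_im_ne_zero him), ?_⟩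
        have hx := inv_le_halfCot (t := t) ⟨ht.1, by linarith [ht.2, hh.2]⟩
        have hx' : 16 / h ≤ halfCot t := by
          refine le_trans ?_ hx
          rw [inv_eq_one_div, div_le_div_iff₀ h0 ht.1]
          linarith [ht.2]
        have h16 : 2 ≤ 16 / h := by
          rw [le_div_iff₀ h0]; linarith [hh.2]
        rw [outerSymbol_exp ht']
        refine (norm_halfPlaneSymbol_sub_one_le ha hb (h16.trans hx')).trans ?_
        calc 4 / halfCot t ≤ 4 / (16 / h) := by gcongr
          _ = h / 4 := by field_simp; norm_num
  simpa only [Real.rpow_one] using key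

theorem isTheta_carlesonFunction_twistedSymbol (ha : a ∈ Ioo (0 : ℝ) 1)
    (hb : b ∈ Ioo (0 : ℝ) 1) (hab : b⁻¹ ≤ 1 + (2 - a)⁻¹) :
    (fun h : ℝ => carlesonFunction (pullbackMeasure (twistedSymbol a b)) h) =Θ[𝓝[>] 0]
      (fun h : ℝ => h ^ b⁻¹) := by
  have ha' := abs_lt_one_of_mem_Ioo ha
  have hb' := abs_lt_one_of_mem_Ioo hb
  obtain ⟨C, hC, hup⟩ := exists_volume_twistedSymbol_le ha hb hab
  set K := 2 / Real.cos (Real.pi / 2 * b) + 1 with hK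
  have hK1 : 1 ≤ K := by
    have := div_pos two_pos (cos_half_pi_mul_pos hb)
    linarith
  refine isTheta_carlesonFunction (C := C) (c := (2 * Real.pi)⁻¹ * ((4 * K)⁻¹) ^ b⁻¹)
    (by positivity) ?_ ?_
  · filter_upwards [hup, self_mem_nhdsWithin] with h hh h0
    refine pullbackMeasure_carlesonWindow_le measurable_twistedSymbol
      (continuousAt_twistedSymbol ha hb) (fun t ht => ?_)
      (mul_nonneg hC (Real.rpow_nonneg (le_of_lt h0) _)) hh
    have him := coe_exp_im_ne_zero ht
    rw [coe_exp_neg, twistedSymbol_conj (Circle.norm_coe _).le (ne_one_of_im_ne_zero him)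
      (ne_neg_one_of_im_ne_zero him)]
  · filter_upwards [Ioo_mem_nhdsGT (show (0 : ℝ) < 1 by norm_num)] with h hh
    have h0 := hh.1
    -- The length s solves K s^b = h/4, so the arc (π - s, π) at the corner is mapped into the
    -- window at 1.
    set s := ((4 * K)⁻¹ * h) ^ b⁻¹ with hs
    have hs0 : 0 < s := by positivity
    have hs1 : s ≤ 1 := by
      refine Real.rpow_le_one (by positivity) ?_ (inv_nonneg.2 hb.1.le)
      rw [inv_mul_le_iff₀ (by positivity)]
      linarith [hh.2]
    have hsb : s ^ b = (4 * K)⁻¹ * h := Real.rpow_inv_rpow (by positivity) hb.1.ne'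
    have := le_pullbackMeasure_carlesonWindow measurable_twistedSymbol
      (continuousAt_twistedSymbol ha hb) (u := Real.pi - s) (v := Real.pi) hh.2
      (by linarith [Real.pi_gt_three]) le_rfl (fun t ht => ?_)
    · convert this using 2
      rw [sub_sub_cancel, hs, Real.mul_rpow (by positivity) h0.le, mul_assoc]
    · have ht' : t ∈ Ioo 0 Real.pi := ⟨by linarith [ht.1, Real.pi_gt_three], ht.2⟩
      have him := coe_exp_im_ne_zero ht'
      refine ⟨norm_twistedSymbol_lt_one ha' hb' (Circle.norm_coe _).le (ne_one_of_im_ne_zero him)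
        (ne_neg_one_of_im_ne_zero him), ?_⟩
      have hx0 := halfCot_pos ht'
      have hx : halfCot t ≤ s :=
        (halfCot_le_pi_sub ht' (by linarith [ht.1])).trans (by linarith [ht.1])
      rw [twistedSymbol_exp ht']
      refine (norm_halfPlaneSymbol_mul_exp_sub_one_le ha hb hx0 (hx.trans hs1)).trans ?_
      calc K * halfCot t ^ b ≤ K * s ^ b := by
            gcongr
            exact hb.1.le
        _ = h / 4 := by rw [hsb]; field_simp

end Estimates

end

theorem mainTheorem2 (α : ℝ) (hα₁ : 1 < α) (hα₂ : α < 2) :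
    ∃ φ₁ φ₂ : ℂ → ℂ, IsSymbol φ₁ ∧ IsSymbol φ₂ ∧
      (∀ᵐ ξ ∂circleMeasure, ‖boundaryValue φ₁ ξ‖ = ‖boundaryValue φ₂ ξ‖) ∧
      (fun h : ℝ => carlesonFunction (pullbackMeasure φ₁) h) =Θ[𝓝[>] 0] (fun h : ℝ => h) ∧
      (fun h : ℝ => carlesonFunction (pullbackMeasure φ₂) h) =Θ[𝓝[>] 0]
        (fun h : ℝ => h ^ α) := by
  have ha : α - 1 ∈ Ioo (0 : ℝ) 1 := ⟨by linarith, by linarith⟩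
  have hb : α⁻¹ ∈ Ioo (0 : ℝ) 1 := ⟨by positivity, inv_lt_one_of_one_lt₀ hα₁⟩
  have ha' := abs_lt_one_of_mem_Ioo ha
  have hb' := abs_lt_one_of_mem_Ioo hb
  refine ⟨outerSymbol (α - 1) α⁻¹, twistedSymbol (α - 1) α⁻¹,
    isSymbol_of_differentiableAt (fun z => differentiableAt_outerSymbol ha' hb')
      (fun z => norm_outerSymbol_lt_one ha' hb'),
    isSymbol_of_differentiableAt (fun z => differentiableAt_twistedSymbol ha' hb')
      (fun z => norm_twistedSymbol_lt_one ha' hb'), ?_,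
    isTheta_carlesonFunction_outerSymbol ha hb, ?_⟩
  · filter_upwards [ae_circleMeasure_im_ne_zero] with ξ hξ
    rw [boundaryValue_eq_of_continuousAt (continuousAt_outerSymbol ha hb ξ hξ),
      boundaryValue_eq_of_continuousAt (continuousAt_twistedSymbol ha hb ξ hξ),
      norm_twistedSymbol_circle (ne_one_of_im_ne_zero hξ)]
  · have hab : (α⁻¹)⁻¹ ≤ 1 + (2 - (α - 1))⁻¹ := by
      rw [inv_inv, ← sub_le_iff_le_add', inv_eq_one_div, le_div_iff₀ (by linarith)]
      nlinarith [sq_nonneg (α - 2)]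
    simpa only [inv_inv] using isTheta_carlesonFunction_twistedSymbol ha hb hab
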